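/- Let $X$ be a real Hausdorff locally convex topological vector space, let $n\ge 1$, and let $f_1,\dots,f_n:X\to\overline{\mathbb R}=\mathbb R\cup\{-\infty,+\infty\}$ be convex, i.e. each epigraph $\{(x,r)\in X\times\mathbb R: f_k(x)\le r\}$ is convex. Put $f:=\max_{1\le k\le n}f_k$ and suppose that $\operatorname{dom} f:=\{x\in X: f(x)<+\infty\}\ne\emptyset$. Assume that at least one of the following holds: (i) every $f_k$ is proper, i.e. $\operatorname{dom} f_k\neq\emptyset$ and $f_k(x)>-\infty$ for all $x\in X$; (ii) every $f_k$ is lower semicontinuous. Then, with $\Delta_n:=\{\lambda\in\mathbb R^n:\lambda_k\ge 0,\ \sum_{k=1}^n\lambda_k=1\}$ and the conventions $(+\infty)+(-\infty)=(-\infty)+(+\infty)=+\infty$, $0\cdot(+\infty)=+\infty$, $0\cdot(-\infty)=0$, $$\inf_{x\in X} f(x)=\max_{\lambda\in\Delta_n}\ \inf_{x\in X}\ \sum_{k=1}^n\lambda_k f_k(x),$$ where the maximum over $\Delta_n$ is attained. -/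

import Mathlib

noncomputable section

namespace ExtConvex

/-- Effective domain of an extended real-valued function. -/
def dom {X : Type*} (f : X → EReal) : Set X := {x | f x < ⊤}

/-- Epigraph of an extended real-valued function, as a subset of `X × ℝ`. -/
def epi {X : Type*} (f : X → EReal) : Set (X × ℝ) := {p | f p.1 ≤ (p.2 : EReal)}

/-- An extended real-valued function is convex if its epigraph is convex. -/
def IsConvex {X : Type*} [AddCommGroup X] [Module ℝ X] (f : X → EReal) : Prop :=
  Convex ℝ (epi f)

/-- Proper: finite somewhere (nonempty domain) and never `-∞`. -/
def IsProper {X : Type*} (f : X → EReal) : Prop :=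
  (dom f).Nonempty ∧ ∀ x, ⊥ < f x

open Classical in
/-- Addition with `(+∞) + (-∞) = (-∞) + (+∞) = +∞` (in Mathlib this sum is `-∞`). -/
def upperAdd (a b : EReal) : EReal := if a = ⊤ ∨ b = ⊤ then ⊤ else a + b

open Classical in
/-- Multiplication by a real with `0 · (+∞) = +∞` and `0 · (-∞) = 0`
(in Mathlib `0 * ⊤ = 0`). -/
def upperMul (t : ℝ) (a : EReal) : EReal := if t = 0 ∧ a = ⊤ then ⊤ else (t : EReal) * a

open Classical in
/-- Finite sums with respect to `upperAdd`; see `upperSum_zero` and `upperSum_succ`. -/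
def upperSum {n : ℕ} (a : Fin n → EReal) : EReal := if ∃ k, a k = ⊤ then ⊤ else ∑ k, a k

theorem upperSum_zero (a : Fin 0 → EReal) : upperSum a = 0 := by
  simp [upperSum]

theorem upperSum_succ {n : ℕ} (a : Fin (n + 1) → EReal) :
    upperSum a = upperAdd (a 0) (upperSum fun k : Fin n => a k.succ) := by
  have key : ∀ {m : ℕ} (b : Fin m → EReal), (∀ k, b k ≠ ⊤) → ∑ k, b k ≠ ⊤ := by
    intro m b
    induction m with
    | zero => intro _; simp
    | succ m ih =>
      intro hb
      rw [Fin.sum_univ_succ]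
      exact EReal.add_ne_top (hb 0) (ih _ fun k => hb k.succ)
  by_cases h0 : a 0 = ⊤
  · have : ∃ k, a k = ⊤ := ⟨0, h0⟩
    simp [upperSum, upperAdd, this, h0]
  · by_cases h : ∃ k : Fin n, a k.succ = ⊤
    · have : ∃ k, a k = ⊤ := h.elim fun k hk => ⟨k.succ, hk⟩
      simp [upperSum, upperAdd, this, h]
    · have h' : ¬ ∃ k, a k = ⊤ := by
        rw [Fin.exists_fin_succ]
        exact fun hh => hh.elim h0 h
      have hs := key (fun k : Fin n => a k.succ) (fun k hk => h ⟨k, hk⟩)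
      simp only [upperSum, upperAdd, if_neg h, if_neg h']
      rw [if_neg (by tauto), Fin.sum_univ_succ]

/-- The combination `x ↦ ∑ k, l k · f k x`, with the above conventions. -/
def combo {X : Type*} {n : ℕ} (f : Fin n → X → EReal) (l : Fin n → ℝ) (x : X) : EReal :=
  upperSum fun k => upperMul (l k) (f k x)

end ExtConvex

end

namespace ExtConvex

/-! Weights summing to one give the inequality "≥" at each point. For the converse, let `m` be the
infimum of the maximum, the case `m = ⊥` being trivial. The convex set `upperImage f` in `ℝⁿ` misses
the open orthant of vectors with all coordinates below `m`, so Hahn–Banach separates the two. Since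
the set is upward closed, the separating functional has nonnegative coefficients; normalised, they
are the maximising weights (`exists_stdSimplex_le_of_convex`). `le_combo_of_upperImage` carries the
bound back to the extended-valued functions. -/

/-- The vectors of `ℝⁿ` that dominate `(f₁ x, …, fₙ x)` for some `x`. -/
def upperImage {X : Type*} {n : ℕ} (f : Fin n → X → EReal) : Set (Fin n → ℝ) :=
  {t | ∃ x, ∀ k, f k x ≤ (t k : EReal)}

theorem convex_upperImage {X : Type*} [AddCommGroup X] [Module ℝ X] {n : ℕ}
    {f : Fin n → X → EReal} (hf : ∀ k, IsConvex (f k)) : Convex ℝ (upperImage f) := by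
  rintro t ⟨x, hx⟩ s ⟨y, hy⟩ a b ha hb hab
  refine ⟨a • x + b • y, fun k => ?_⟩
  have hxk : (x, t k) ∈ epi (f k) := hx k
  have hyk : (y, s k) ∈ epi (f k) := hy k
  exact hf k hxk hyk ha hb hab

theorem upperImage_nonempty {X : Type*} {n : ℕ} {f : Fin n → X → EReal}
    (hdom : (dom fun x => ⨆ k, f k x).Nonempty) : (upperImage f).Nonempty := by
  obtain ⟨x, hx⟩ := hdom
  obtain ⟨r, hr, -⟩ := EReal.lt_iff_exists_real_btwn.1 hx
  exact ⟨fun _ => r, x, fun k => (le_iSup (fun k => f k x) k).trans hr.le⟩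

/-- A convex set that is stable under increasing a coordinate and misses the open orthant
`{s | ∀ k, s k < m}` lies above `m` for some weights in the simplex. -/
theorem exists_stdSimplex_le_of_convex {ι : Type*} [Fintype ι] {C : Set (ι → ℝ)}
    (hC : Convex ℝ C) (hne : C.Nonempty) (hup : ∀ t ∈ C, ∀ s, t ≤ s → s ∈ C) {m : ℝ}
    (hm : ∀ t ∈ C, ∃ k, m ≤ t k) :
    ∃ l ∈ stdSimplex ℝ ι, ∀ t ∈ C, m ≤ ∑ k, l k * t k := by
  classical
  obtain ⟨t₀, ht₀⟩ := hne
  have hSeq : {s : ι → ℝ | ∀ k, s k < m} = Set.pi Set.univ fun _ => Set.Iio m := by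
    ext s; simp
  obtain ⟨φ, u, hS, hCu⟩ := geometric_hahn_banach_open (s := {s : ι → ℝ | ∀ k, s k < m}) (t := C)
    (hSeq ▸ convex_pi fun _ _ => convex_Iio m)
    (hSeq ▸ isOpen_set_pi Set.finite_univ fun _ _ => isOpen_Iio) hC
    (Set.disjoint_left.2 fun s hs hsC => by
      obtain ⟨k, hk⟩ := hm s hsC
      exact (hs k).not_ge hk)
  set c : ι → ℝ := fun k => φ (Pi.single k 1) with hc
  have hφ : ∀ t, φ t = ∑ k, c k * t k := fun t => by
    conv_lhs => rw [pi_eq_sum_univ' t]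
    simp only [map_sum, map_smul, smul_eq_mul, hc, mul_comm]
  have hc0 : ∀ k, 0 ≤ c k := by
    intro k
    by_contra! hk
    -- Raising coordinate `k` of `t₀` by this amount brings `φ` down to `u - 1`, below its bound on
    -- `C`.
    have hpos : 0 ≤ (φ t₀ - u + 1) / (-c k) :=
      div_nonneg (by linarith [hCu t₀ ht₀]) (by linarith)
    have := hCu _ (hup t₀ ht₀ (t₀ + ((φ t₀ - u + 1) / (-c k)) • Pi.single k 1)
      (le_add_of_nonneg_right (smul_nonneg hpos (Pi.single_nonneg.2 zero_le_one))))
    rw [map_add, map_smul, smul_eq_mul] at this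
    have h1 : (φ t₀ - u + 1) / (-c k) * φ (Pi.single k 1) = -(φ t₀ - u + 1) := by
      change (φ t₀ - u + 1) / (-c k) * c k = _
      field_simp [hk.ne]
    linarith
  have hconst : ∀ r : ℝ, φ (fun _ => r) = (∑ k, c k) * r := fun r => by
    rw [hφ, Finset.sum_mul]
  have hlt : ∀ r < m, (∑ k, c k) * r < u := fun r hr => hconst r ▸ hS _ fun _ => hr
  -- If all coefficients vanished, then `φ = 0`, so the orthant would give `0 < u` and `C` would
  -- give `u ≤ 0`.
  have hσ : 0 < ∑ k, c k := by
    refine (Finset.sum_nonneg fun k _ => hc0 k).lt_of_ne fun h => ?_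
    have hz : ∀ k, c k = 0 := fun k =>
      (Finset.sum_eq_zero_iff_of_nonneg fun k _ => hc0 k).1 h.symm k (Finset.mem_univ k)
    have h1 := hlt (m - 1) (by linarith)
    have h2 := hCu t₀ ht₀
    rw [hφ] at h2
    simp only [hz, zero_mul, Finset.sum_const_zero] at h1 h2
    linarith
  have hmu : m ≤ u / ∑ k, c k :=
    le_of_forall_lt fun r hr => (lt_div_iff₀ hσ).2 (by linarith [hlt r hr])
  refine ⟨fun k => c k / ∑ j, c j, ⟨fun k => div_nonneg (hc0 k) hσ.le, ?_⟩, fun t ht => ?_⟩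
  · rw [← Finset.sum_div, div_self hσ.ne']
  · have h2 : u / ∑ k, c k ≤ φ t / ∑ k, c k := div_le_div_of_nonneg_right (hCu t ht) hσ.le
    refine hmu.trans (h2.trans_eq ?_)
    rw [hφ, Finset.sum_div]
    exact Finset.sum_congr rfl fun k _ => by ring

theorem coe_finsetSum {ι : Type*} (s : Finset ι) (g : ι → ℝ) :
    ((∑ k ∈ s, g k : ℝ) : EReal) = ∑ k ∈ s, (g k : EReal) := by
  classical
  induction s using Finset.induction_on with
  | empty => simp
  | insert a s ha ih => rw [Finset.sum_insert ha, Finset.sum_insert ha, EReal.coe_add, ih]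

theorem upperMul_ne_top {t : ℝ} (ht : 0 ≤ t) {a : EReal} (ha : a ≠ ⊤) : upperMul t a ≠ ⊤ := by
  rw [upperMul, if_neg fun h => ha h.2]
  induction a with
  | bot =>
    rcases ht.eq_or_lt with rfl | h
    · simp
    · simp [EReal.coe_mul_bot_of_pos h]
  | coe r => rw [← EReal.coe_mul]; exact EReal.coe_ne_top _
  | top => exact absurd rfl ha

theorem upperMul_top {t : ℝ} (ht : 0 ≤ t) : upperMul t ⊤ = ⊤ := by
  rcases ht.eq_or_lt with rfl | h
  · simp [upperMul]
  · simp [upperMul, EReal.coe_mul_top_of_pos h]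

theorem combo_eq_top {X : Type*} {n : ℕ} {f : Fin n → X → EReal} {l : Fin n → ℝ}
    (hl : l ∈ stdSimplex ℝ (Fin n)) {x : X} {k : Fin n} (hx : f k x = ⊤) :
    combo f l x = ⊤ :=
  if_pos ⟨k, by simpa only [hx] using upperMul_top (hl.1 k)⟩

theorem combo_eq_sum {X : Type*} {n : ℕ} {f : Fin n → X → EReal} {l : Fin n → ℝ}
    (hl : l ∈ stdSimplex ℝ (Fin n)) {x : X} (hx : ∀ k, f k x ≠ ⊤) :
    combo f l x = ∑ k, (l k : EReal) * f k x := by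
  rw [combo, upperSum, if_neg fun ⟨k, hk⟩ => upperMul_ne_top (hl.1 k) (hx k) hk]
  exact Finset.sum_congr rfl fun k _ => if_neg fun h => hx k h.2

theorem combo_le_iSup {X : Type*} {n : ℕ} (f : Fin n → X → EReal) {l : Fin n → ℝ}
    (hl : l ∈ stdSimplex ℝ (Fin n)) (x : X) : combo f l x ≤ ⨆ k, f k x := by
  -- Comparing with reals `r` above the supremum leaves only points where no `f k x` is `⊤`.
  refine EReal.le_of_forall_lt_iff_le.1 fun r hr => ?_
  have hk : ∀ k, f k x < r := fun k => (le_iSup (fun k => f k x) k).trans_lt hr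
  rw [combo_eq_sum hl fun k => (hk k).ne_top]
  calc ∑ k, (l k : EReal) * f k x ≤ ∑ k, ((l k * r : ℝ) : EReal) :=
        Finset.sum_le_sum fun k _ => by
          rw [EReal.coe_mul]
          exact mul_le_mul_of_nonneg_left (hk k).le (EReal.coe_nonneg.2 (hl.1 k))
    _ = r := by rw [← coe_finsetSum, ← Finset.sum_mul, hl.2, one_mul]

/-- If `m ≤ ∑ lₖ tₖ` for all `t` dominating some `(f₁ x, …, fₙ x)`, then `m` is a lower bound of
the combination. The weight of `fₖ` vanishes as soon as `fₖ x = ⊥` at a point `x` of the common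
domain. -/
theorem le_combo_of_upperImage {X : Type*} {n : ℕ} {f : Fin n → X → EReal} {l : Fin n → ℝ}
    (hl : l ∈ stdSimplex ℝ (Fin n)) {m : ℝ} (h : ∀ t ∈ upperImage f, m ≤ ∑ k, l k * t k)
    (x : X) : (m : EReal) ≤ combo f l x := by
  by_cases hx : ∃ k, f k x = ⊤
  · obtain ⟨k, hk⟩ := hx
    rw [combo_eq_top hl hk]
    exact le_top
  push Not at hx
  have hle : ∀ k, f k x ≤ ((f k x).toReal : EReal) := fun k => EReal.le_coe_toReal (hx k)
  have hbot : ∀ k, f k x = ⊥ → l k = 0 := by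
    intro k hk
    by_contra hlk
    have hpos : 0 < l k := (hl.1 k).lt_of_ne' hlk
    set S := ∑ j, l j * (f j x).toReal with hS
    -- As `f k x = ⊥`, coordinate `k` may be any real; this choice makes the weighted sum `m - 1`.
    -- The old coordinate contributes nothing to `S` because `toReal ⊥ = 0`.
    have hmem : Function.update (fun j => (f j x).toReal) k ((m - S - 1) / l k) ∈
        upperImage f := by
      refine ⟨x, fun j => ?_⟩
      rcases eq_or_ne j k with rfl | hj
      · simp [hk]
      · simpa [hj] using hle j
    have h1 := h _ hmem
    have h2 : ∑ j, l j * Function.update (fun j => (f j x).toReal) k ((m - S - 1) / l k) j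
        = S + (m - S - 1) := by
      have hS' : S = ∑ j ∈ Finset.univ.erase k, l j * (f j x).toReal := by
        rw [hS, ← Finset.add_sum_erase _ _ (Finset.mem_univ k), hk, EReal.toReal_bot, mul_zero,
          zero_add]
      rw [← Finset.add_sum_erase _ _ (Finset.mem_univ k), Function.update_self,
        mul_div_cancel₀ _ hlk, add_comm]
      congr 1
      exact (Finset.sum_congr rfl fun j hj => by
        rw [Function.update_of_ne (Finset.ne_of_mem_erase hj)]).trans hS'.symm
    linarith
  rw [combo_eq_sum hl hx]
  have hsum : ∑ k, (l k : EReal) * f k x = ((∑ k, l k * (f k x).toReal : ℝ) : EReal) := by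
    rw [coe_finsetSum]
    refine Finset.sum_congr rfl fun k _ => ?_
    by_cases hk : f k x = ⊥
    · simp [hbot k hk]
    · rw [EReal.coe_mul, EReal.coe_toReal (hx k) hk]
  rw [hsum, EReal.coe_le_coe_iff]
  exact h _ ⟨x, hle⟩

/-- The infimum of the maximum is a lower bound of some convex combination. Neither properness nor
lower semicontinuity is needed: the separation takes place in `ℝⁿ`, points outside the common
domain give the value `⊤`, and functions that take the value `⊥` inside it get weight zero. -/
theorem exists_stdSimplex_iInf_le {X : Type*} [AddCommGroup X] [Module ℝ X] {n : ℕ} (hn : 1 ≤ n)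
    {f : Fin n → X → EReal} (hconv : ∀ k, IsConvex (f k))
    (hdom : (dom fun x => ⨆ k, f k x).Nonempty) :
    ∃ l ∈ stdSimplex ℝ (Fin n), ∀ x, (⨅ x, ⨆ k, f k x) ≤ combo f l x := by
  have : Nonempty (Fin n) := ⟨⟨0, hn⟩⟩
  have htop : (⨅ x, ⨆ k, f k x) ≠ ⊤ := by
    obtain ⟨x, hx⟩ := hdom
    exact ((iInf_le _ x).trans_lt hx).ne
  by_cases hbot : (⨅ x, ⨆ k, f k x) = ⊥
  · exact ⟨_, single_mem_stdSimplex ℝ ⟨0, hn⟩, fun x => hbot ▸ bot_le⟩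
  lift (⨅ x, ⨆ k, f k x) to ℝ using ⟨htop, hbot⟩ with m hm
  obtain ⟨l, hl, h⟩ := exists_stdSimplex_le_of_convex (m := m) (convex_upperImage hconv)
    (upperImage_nonempty hdom)
    (fun t ⟨x, hx⟩ s hts => ⟨x, fun k => (hx k).trans (EReal.coe_le_coe_iff.2 (hts k))⟩)
    (fun t ⟨x, hx⟩ => by
      obtain ⟨k, hk⟩ := Finite.exists_max t
      refine ⟨k, EReal.coe_le_coe_iff.1 ?_⟩
      rw [hm]
      exact (iInf_le _ x).trans (iSup_le fun j => (hx j).trans (EReal.coe_le_coe_iff.2 (hk j))))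
  exact ⟨l, hl, le_combo_of_upperImage hl h⟩

end ExtConvex

theorem mainTheorem4 {X : Type*} [AddCommGroup X] [Module ℝ X] [TopologicalSpace X]
    [IsTopologicalAddGroup X] [ContinuousSMul ℝ X] [LocallyConvexSpace ℝ X] [T2Space X]
    (n : ℕ) (hn : 1 ≤ n) (f : Fin n → X → EReal)
    (hconv : ∀ k, ExtConvex.IsConvex (f k))
    (hdom : (ExtConvex.dom fun x => ⨆ k, f k x).Nonempty)
    (h : (∀ k, ExtConvex.IsProper (f k)) ∨ (∀ k, LowerSemicontinuous (f k))) :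
    IsGreatest ((fun l : Fin n → ℝ => ⨅ x, ExtConvex.combo f l x) '' stdSimplex ℝ (Fin n))
      (⨅ x, ⨆ k, f k x) := by
  have hle : ∀ l ∈ stdSimplex ℝ (Fin n), (⨅ x, ExtConvex.combo f l x) ≤ ⨅ x, ⨆ k, f k x :=
    fun l hl => iInf_mono fun x => ExtConvex.combo_le_iSup f hl x
  obtain ⟨l, hl, hlf⟩ := ExtConvex.exists_stdSimplex_iInf_le hn hconv hdom
  refine ⟨⟨l, hl, le_antisymm (hle l hl) (le_iInf hlf)⟩, ?_⟩
  rintro _ ⟨l', hl', rfl⟩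
  exact hle l' hl'
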